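/- Let $n\ge 0$ and $d\ge 1$ be integers, let $(\Omega,\mathcal F,\mathbb P)$ be a probability space with a filtration $(\mathcal F_t)_{t\ge 0}$, let $\lambda\in\mathbb R^d$ have nonnegative entries, and let $Q\in\mathbb R^{d\times d}$ have nonnegative off-diagonal entries and zero column sums ($Q_{ij}$, $i\ne j$, is the intensity of a transition from state $j$ to state $i$). Let $X$ be an adapted càdlàg process with values in the set $\{e_1,\dots,e_d\}$ of standard basis vectors of $\mathbb R^d$ that is a Markov chain relative to $(\mathcal F_t)$ with intensity matrix $Q$, i.e. $\mathbb E[X_t\mid\mathcal F_s]=\exp(Q(t-s))X_s$ a.s. for $0\le s\le t$. Let $N$ be an adapted counting process (nondecreasing, càdlàg, a.s. with all jumps of size one, not necessarily started at $0$) with values in $\{0,1,\dots,n\}$ and with intensity $\lambda^\top X_t\,(n-N_t)$, i.e. $$N_t-\int_0^t \lambda^\top X_u\,(n-N_u)\,\mathrm du$$ is an $(\mathcal F_t)$-martingale. Assume that a.s. $X$ and $N$ have no common jump times. Put $Q_{m\lambda}=Q-m\,\mathrm{diag}(\lambda)$ for integers $m\ge 0$, and for $0\le k\le n$ and $0\le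 s\le t$ $$\zeta^k_t=\mathbf 1_{\{N_t=k\}}X_t,\qquad \zeta^k_{t|s}=\mathbb E[\mathbf 1_{\{N_t=k\}}X_t\mid\mathcal F_s].$$ **Proposition.** For all $0\le s\le t$ and $0\le k\le n$, almost surely $$\zeta^k_{t|s}=\sum_{j=0}^k\binom{n-j}{k-j}\sum_{i=0}^k(-1)^{k-i}\binom{k-j}{k-i}\exp\big(Q_{(n-i)\lambda}(t-s)\big)\,\zeta^j_s .$$ Moreover, with $\mathbf 1=(1,\dots,1)^\top\in\mathbb R^d$, almost surely $\mathbb P(N_t=k\mid\mathcal F_s)=\mathbf 1^\top\zeta^k_{t|s}$, and explicitly $$\mathbb P(N_t=k\mid\mathcal F_s)=\sum_{j=0}^n\binom{n-j}{n-k}\sum_{i=j}^k(-1)^{k-i}\binom{k-j}{k-i}\,\mathbf 1^\top\exp\big(Q_{(n-i)\lambda}(t-s)\big)X_s\,\mathbf 1_{\{N_s=j\}} .$$ -/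

import Mathlib

open MeasureTheory ProbabilityTheory Filter Topology
open scoped NNReal Matrix

/-- A path `[0, ∞) → E` is càdlàg: right-continuous with left limits. -/
def IsCadlagPath {E : Type*} [TopologicalSpace E] (f : ℝ≥0 → E) : Prop :=
  ∀ t, ContinuousWithinAt f (Set.Ici t) t ∧ ∃ l, Tendsto f (𝓝[<] t) (𝓝 l)

/-- Intensity ("transition") matrices, in the convention that `Q i j`, for `i ≠ j`, is the intensity
of a transition from state `j` to state `i`, so that the column sums vanish. -/
structure IsIntensityMatrix {d : ℕ} (Q : Matrix (Fin d) (Fin d) ℝ) : Prop where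
  offDiag_nonneg : ∀ i j, i ≠ j → 0 ≤ Q i j
  colSum_eq_zero : ∀ j, ∑ i, Q i j = 0

/-- `X` is a càdlàg Markov chain relative to the filtration `ℱ`, with values in the standard basis
vectors of `ℝ^d` and with intensity matrix `Q`: the conditional law of `X t` given `ℱ s`, which is
the vector `E[X t | ℱ s]` as `X` is basis-vector valued, is `exp (Q (t - s)) X s`. -/
structure IsMarkovChain {Ω : Type*} {mΩ : MeasurableSpace Ω} (μ : Measure Ω)
    (ℱ : Filtration ℝ≥0 mΩ) {d : ℕ} (Q : Matrix (Fin d) (Fin d) ℝ)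
    (X : ℝ≥0 → Ω → Fin d → ℝ) : Prop where
  intensityMatrix : IsIntensityMatrix Q
  adapted : ∀ t, Measurable[ℱ t] (X t)
  mem_basis : ∀ t ω, ∃ i, X t ω = Pi.single i 1
  cadlag : ∀ ω, IsCadlagPath fun t => X t ω
  markov : ∀ s t : ℝ≥0, s ≤ t →
    μ[X t | ℱ s] =ᵐ[μ] fun ω => NormedSpace.exp (((t : ℝ) - s) • Q) *ᵥ X s ω

/-- `N` is an adapted counting process: integer valued, nondecreasing, càdlàg, and almost surely
all its jumps have size one. The initial value need not be `0`. -/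
structure IsCountingProcess {Ω : Type*} {mΩ : MeasurableSpace Ω} (μ : Measure Ω)
    (ℱ : Filtration ℝ≥0 mΩ) (N : ℝ≥0 → Ω → ℕ) : Prop where
  adapted : ∀ t, Measurable[ℱ t] (N t)
  mono : ∀ ω, Monotone fun t => N t ω
  cadlag : ∀ ω, IsCadlagPath fun t => N t ω
  unit_jumps : ∀ᵐ ω ∂μ, ∀ t, ∀ᶠ u in 𝓝[<] t, N t ω ≤ N u ω + 1

/-- `N` has intensity process `h` relative to `ℱ`: the process `N t - ∫₀ᵗ h u du` is an
`ℱ`-martingale. -/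
def HasIntensity {Ω : Type*} {mΩ : MeasurableSpace Ω} (μ : Measure Ω)
    (ℱ : Filtration ℝ≥0 mΩ) (N : ℝ≥0 → Ω → ℕ) (h : ℝ≥0 → Ω → ℝ) : Prop :=
  Martingale (fun t ω => (N t ω : ℝ) - ∫ u in (0 : ℝ)..t, h u.toNNReal ω) ℱ μ

/-- The Markov modulated model with `n` obligors: `X` is a Markov chain with intensity matrix `Q`,
`N` counts the defaults, `N` has intensity `(λᵀ X) (n - N)`, and almost surely `X` and `N` never
jump at the same time. -/
structure IsMarkovModulated {Ω : Type*} {mΩ : MeasurableSpace Ω} (μ : Measure Ω)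
    (ℱ : Filtration ℝ≥0 mΩ) {d : ℕ} (n : ℕ) (Q : Matrix (Fin d) (Fin d) ℝ) (lam : Fin d → ℝ)
    (X : ℝ≥0 → Ω → Fin d → ℝ) (N : ℝ≥0 → Ω → ℕ) : Prop where
  lam_nonneg : ∀ i, 0 ≤ lam i
  markovChain : IsMarkovChain μ ℱ Q X
  counting : IsCountingProcess μ ℱ N
  le_n : ∀ t ω, N t ω ≤ n
  intensity : HasIntensity μ ℱ N fun t ω => (lam ⬝ᵥ X t ω) * ((n : ℝ) - N t ω)
  no_common_jumps : ∀ᵐ ω ∂μ, ∀ t,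
    ContinuousAt (fun u => X u ω) t ∨ ContinuousAt (fun u => N u ω) t

/-- The matrix `Q_{kλ} = Q - k diag(λ)`. -/
def Qlam {d : ℕ} (Q : Matrix (Fin d) (Fin d) ℝ) (lam : Fin d → ℝ) (k : ℕ) :
    Matrix (Fin d) (Fin d) ℝ :=
  Q - (k : ℝ) • Matrix.diagonal lam

/-- The vector `ζ^k_t = 1{N_t = k} X_t`. -/
def zeta {Ω : Type*} {d : ℕ} (X : ℝ≥0 → Ω → Fin d → ℝ) (N : ℝ≥0 → Ω → ℕ) (k : ℕ) (t : ℝ≥0)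
    (ω : Ω) : Fin d → ℝ :=
  if N t ω = k then X t ω else 0

/-! ### Propagators: bounds and first-order comparison. -/

section MatrixExponential

variable {d : ℕ}

/-! The functions `f ν = (n - ν).choose m` are eigenfunctions of the death mechanism: `(f (ν + 1) -
f ν) (n - ν) = -m f ν`. As `X` and `N` never jump together, the drift of `f(N) X` has no cross term.
It is `f(N) Q X + (f(N+1) - f(N)) (n - N) (λᵀX) X`, and `(λᵀX) X = diag(λ) X` for basis vectors, so
the drift equals `Q_{mλ} f(N) X`. Hence `E[f(N_t) X_t | ℱ_s] = exp(Q_{mλ}(t-s)) f(N_s) X_s`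
(`condExp_smul_eq`). Binomial inversion writes `1{N = k}` as a combination of the functions with `m
= n - i`, `i ≤ k` (`sum_neg_one_pow_mul_choose_mul_choose`), and linearity gives the formula.

The drift computation is made rigorous by partitions instead of stochastic integration. On each of
`K` equal steps, the martingale increments of `X` and `N` are subtracted; they integrate to zero
over `ℱ_s`-sets (`integrable_stepError_and_setIntegral`). The remaining `stepError` is `o(1/K)` on
steps without jumps and `O(1/K)` on the boundedly many steps with one, so along almost every path
the errors sum to something tending to zero (`IsModulatedPath.tendsto_sum_norm_stepError`). Since `N
≤ n`, the sums are bounded uniformly in the path (`sum_norm_stepError_le`), and dominated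
convergence concludes (`setIntegral_smul_eq`). -/

theorem exp_add_smul_mulVec (A : Matrix (Fin d) (Fin d) ℝ) (a b : ℝ) (v : Fin d → ℝ) :
    NormedSpace.exp ((a + b) • A) *ᵥ v
      = NormedSpace.exp (a • A) *ᵥ (NormedSpace.exp (b • A) *ᵥ v) := by
  rw [add_smul, Matrix.exp_add_of_commute, Matrix.mulVec_mulVec]
  exact ((Commute.refl A).smul_left a).smul_right b

section

attribute [local instance] Matrix.linftyOpNormedRing Matrix.linftyOpNormedAlgebra

theorem exists_norm_exp_smul_mulVec_le (A : Matrix (Fin d) (Fin d) ℝ) (T : ℝ) :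
    ∃ D, 0 ≤ D ∧ ∀ u ∈ Set.Icc 0 T, ∀ v : Fin d → ℝ,
      ‖NormedSpace.exp (u • A) *ᵥ v‖ ≤ D * ‖v‖ := by
  have hc : Continuous fun u : ℝ => NormedSpace.exp (u • A) :=
    NormedSpace.exp_continuous.comp (continuous_id.smul continuous_const)
  obtain ⟨D, hD⟩ := (isCompact_Icc (a := (0 : ℝ)) (b := T)).exists_bound_of_continuousOn
    hc.continuousOn
  refine ⟨max D 0, le_max_right _ _, fun u hu v => ?_⟩
  refine (Matrix.linfty_opNorm_mulVec _ _).trans ?_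
  gcongr
  exact (hD u hu).trans (le_max_left _ _)

/-- The two exponentials agree at `0` and their derivatives there differ by `A - B`, so the
remainder is `o(δ)`; summed over `K` steps of length `T / K` it still vanishes. -/
theorem exists_exp_sub_exp_remainder (A B : Matrix (Fin d) (Fin d) ℝ) (T : ℝ) :
    ∃ ρ : ℝ → ℝ, (∀ δ, 0 ≤ ρ δ) ∧ Tendsto (fun K : ℕ => (K : ℝ) * ρ (T / K)) atTop (𝓝 0) ∧
      ∀ δ, ∀ v : Fin d → ℝ,
        ‖NormedSpace.exp (δ • A) *ᵥ v - NormedSpace.exp (δ • B) *ᵥ v - δ • ((A - B) *ᵥ v)‖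
          ≤ ρ δ * ‖v‖ := by
  refine ⟨fun δ => ‖NormedSpace.exp (δ • A) - NormedSpace.exp (δ • B) - δ • (A - B)‖,
    fun _ => norm_nonneg _, ?_, fun δ v => ?_⟩
  · have hA := hasDerivAt_exp_smul_const (𝕂 := ℝ) A 0
    have hB := hasDerivAt_exp_smul_const (𝕂 := ℝ) B 0
    have h := (hA.sub hB).isLittleO
    simp only [zero_smul, NormedSpace.exp_zero, one_mul, sub_zero] at h
    have hT : Tendsto (fun K : ℕ => T / (K : ℝ)) atTop (𝓝 0) :=
      tendsto_const_div_atTop_nhds_zero_nat T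
    have h2 := (h.comp_tendsto hT).norm_left
    have h3 : (fun K : ℕ => (K : ℝ) * ‖NormedSpace.exp ((T / (K : ℝ)) • A)
        - NormedSpace.exp ((T / (K : ℝ)) • B) - (T / (K : ℝ)) • (A - B)‖)
        =o[atTop] fun K : ℕ => (K : ℝ) * (T / (K : ℝ)) := by
      refine (Asymptotics.isBigO_refl _ _).mul_isLittleO ?_
      refine h2.congr (fun K => ?_) (fun K => rfl)
      simp
      rfl
    have h4 : (fun K : ℕ => (K : ℝ) * (T / (K : ℝ))) =O[atTop] fun _ => (1 : ℝ) := by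
      refine Asymptotics.IsBigO.of_bound |T| ?_
      filter_upwards [eventually_gt_atTop 0] with K hK
      have : (K : ℝ) ≠ 0 := by positivity
      rw [mul_div_cancel₀ _ this]
      simp
    exact (Asymptotics.isLittleO_one_iff ℝ).1 (h3.trans_isBigO h4)
  · rw [← Matrix.sub_mulVec, ← Matrix.smul_mulVec, ← Matrix.sub_mulVec]
    exact Matrix.linfty_opNorm_mulVec _ _

end

end MatrixExponential

/-! ### Càdlàg paths with finitely many values. -/

section Paths

theorem Filter.Tendsto.eventually_eq_of_finite {α E : Type*} [TopologicalSpace E] [T1Space E]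
    {g : α → E} {l : Filter α} {c : E} {F : Set E} (hF : F.Finite) (hg : ∀ u, g u ∈ F)
    (h : Tendsto g l (𝓝 c)) : ∀ᶠ u in l, g u = c := by
  have : (F \ {c})ᶜ ∈ 𝓝 c := (hF.subset Set.sdiff_subset).isClosed.isOpen_compl.mem_nhds (by simp)
  filter_upwards [h this] with u hu
  by_contra hne
  exact hu ⟨hg u, hne⟩

theorem IsCadlagPath.exists_locally_const {E : Type*} [TopologicalSpace E] [T1Space E]
    {g : ℝ≥0 → E} (h : IsCadlagPath g) {F : Set E} (hF : F.Finite) (hg : ∀ u, g u ∈ F) (τ : ℝ≥0) :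
    ∃ c, ∀ᶠ u in 𝓝 τ, (τ ≤ u → g u = g τ) ∧ (u < τ → g u = c) := by
  obtain ⟨hr, c, hc⟩ := h τ
  have h1 := Filter.Tendsto.eventually_eq_of_finite hF hg hr
  have h2 := Filter.Tendsto.eventually_eq_of_finite hF hg hc
  rw [eventually_nhdsWithin_iff] at h1 h2
  exact ⟨c, by filter_upwards [h1, h2] with u a b using ⟨a, b⟩⟩

/-- A pair of càdlàg paths with finitely many values, the second one nondecreasing with unit jumps,
that never jump together. -/
structure IsModulatedPath {E : Type*} [TopologicalSpace E] (x : ℝ≥0 → E) (ν : ℝ≥0 → ℕ) : Prop where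
  cadlag_left : IsCadlagPath x
  cadlag_right : IsCadlagPath ν
  finite_left : (Set.range x).Finite
  finite_right : (Set.range ν).Finite
  mono : Monotone ν
  unit_jumps : ∀ t, ∀ᶠ u in 𝓝[<] t, ν t ≤ ν u + 1
  no_common_jumps : ∀ t, ContinuousAt x t ∨ ContinuousAt ν t

/-- Finitely many values make one-sided limits eventually attained, so near `τ` both paths are
constant on each side of `τ`. By right-continuity a change can occur only at `τ` itself, hence the
half-open condition `a < τ ≤ b`. -/
theorem IsModulatedPath.exists_nhd {E : Type*} [TopologicalSpace E] [T1Space E] {x : ℝ≥0 → E}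
    {ν : ℝ≥0 → ℕ} (h : IsModulatedPath x ν) (τ : ℝ≥0) :
    ∃ U ∈ 𝓝 τ, ∀ a b, Set.Icc a b ⊆ U → a ≤ b →
      ((a < τ ∧ τ ≤ b) ∨ ∀ u ∈ Set.Icc a b, x u = x a ∧ ν u = ν a) ∧
      (x b = x a ∨ ν b = ν a) ∧ ν b ≤ ν a + 1 := by
  obtain ⟨c, hc⟩ := h.cadlag_left.exists_locally_const h.finite_left (fun u => ⟨u, rfl⟩) τ
  obtain ⟨c', hc'⟩ := h.cadlag_right.exists_locally_const h.finite_right (fun u => ⟨u, rfl⟩) τ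
  have hj := h.unit_jumps τ
  rw [eventually_nhdsWithin_iff] at hj
  -- The path that is continuous at `τ` is constant on a whole neighbourhood.
  have hn : ∃ V ∈ 𝓝 τ, (∀ u ∈ V, x u = x τ) ∨ (∀ u ∈ V, ν u = ν τ) := by
    rcases h.no_common_jumps τ with hx | hx
    · exact ⟨_, Filter.Tendsto.eventually_eq_of_finite h.finite_left (fun u => ⟨u, rfl⟩) hx,
        Or.inl fun u hu => hu⟩
    · exact ⟨_, Filter.Tendsto.eventually_eq_of_finite h.finite_right (fun u => ⟨u, rfl⟩) hx,
        Or.inr fun u hu => hu⟩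
  obtain ⟨V, hV, hxν⟩ := hn
  refine ⟨_, inter_mem (hc.and (hc'.and hj)) hV, fun a b hU hab => ?_⟩
  have ha := hU (Set.left_mem_Icc.2 hab)
  have hb := hU (Set.right_mem_Icc.2 hab)
  rcases lt_or_ge a τ with haτ | haτ
  · rcases lt_or_ge b τ with hbτ | hbτ
    · have hcst : ∀ u ∈ Set.Icc a b, x u = x a ∧ ν u = ν a := fun u hu => by
        have huU := (hU hu).1
        have huτ := hu.2.trans_lt hbτ
        exact ⟨(huU.1.2 huτ).trans (ha.1.1.2 haτ).symm, (huU.2.1.2 huτ).trans (ha.1.2.1.2 haτ).symm⟩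
      have := hcst b (Set.right_mem_Icc.2 hab)
      exact ⟨Or.inr hcst, Or.inl this.1, by lia⟩
    · refine ⟨Or.inl ⟨haτ, hbτ⟩, ?_, ?_⟩
      · rcases hxν with hx | hx
        · exact Or.inl ((hx b hb.2).trans (hx a ha.2).symm)
        · exact Or.inr ((hx b hb.2).trans (hx a ha.2).symm)
      · rw [hb.1.2.1.1 hbτ]
        exact ha.1.2.2 haτ
  · have hcst : ∀ u ∈ Set.Icc a b, x u = x a ∧ ν u = ν a := fun u hu => by
      have huU := (hU hu).1
      have huτ := haτ.trans hu.1
      exact ⟨(huU.1.1 huτ).trans (ha.1.1.1 haτ).symm, (huU.2.1.1 huτ).trans (ha.1.2.1.1 haτ).symm⟩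
    have := hcst b (Set.right_mem_Icc.2 hab)
    exact ⟨Or.inr hcst, Or.inl this.1, by lia⟩

/-- Compactness of `[s, t]`: `J` consists of the centres of a finite subcover by the local
neighbourhoods and `ε` is a Lebesgue number of it. -/
theorem IsModulatedPath.exists_finset {E : Type*} [TopologicalSpace E] [T1Space E] {x : ℝ≥0 → E}
    {ν : ℝ≥0 → ℕ} (h : IsModulatedPath x ν) (s t : ℝ≥0) :
    ∃ (J : Finset ℝ≥0) (ε : ℝ), 0 < ε ∧ ∀ a b, s ≤ a → a ≤ b → b ≤ t → (b : ℝ) - a < ε →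
      ((∃ τ ∈ J, a < τ ∧ τ ≤ b) ∨ ∀ u ∈ Set.Icc a b, x u = x a ∧ ν u = ν a) ∧
      (x b = x a ∨ ν b = ν a) ∧ ν b ≤ ν a + 1 := by
  choose U hU hU' using h.exists_nhd
  obtain ⟨J, -, hJ⟩ := (isCompact_Icc (a := s) (b := t)).elim_nhds_subcover
    (fun τ => interior (U τ)) fun τ _ => interior_mem_nhds.2 (hU τ)
  obtain ⟨ε, hε, hb⟩ := lebesgue_number_lemma_of_metric (ι := J) (c := fun τ => interior (U τ))
    (isCompact_Icc (a := s) (b := t)) (fun _ => isOpen_interior)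
    (by simpa [Set.iUnion_subtype] using hJ)
  refine ⟨J, ε, hε, fun a b hsa hab hbt hlt => ?_⟩
  obtain ⟨⟨τ, hτ⟩, hball⟩ := hb a ⟨hsa, hab.trans hbt⟩
  have hsub : Set.Icc a b ⊆ U τ := fun u hu => by
    refine interior_subset (hball ?_)
    rw [Metric.mem_ball, NNReal.dist_eq, abs_of_nonneg (sub_nonneg.2 (by exact_mod_cast hu.1))]
    have : (u : ℝ) ≤ b := by exact_mod_cast hu.2
    linarith
  obtain ⟨h1, h2⟩ := hU' τ a b hsub hab
  exact ⟨h1.imp (fun h => ⟨τ, hτ, h⟩) id, h2⟩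

/-- Such a path is the pointwise limit of its values at the next grid point `(⌊uK⌋ + 1) / K`, which
approaches `u` from the right. -/
theorem measurable_of_rightContinuous {E : Type*} [TopologicalSpace E]
    [TopologicalSpace.PseudoMetrizableSpace E]
    [MeasurableSpace E] [BorelSpace E] {g : ℝ≥0 → E}
    (h : ∀ t, ContinuousWithinAt g (Set.Ici t) t) : Measurable g := by
  have hm : ∀ K : ℕ, Measurable fun u : ℝ≥0 => g (((⌊u * K⌋₊ : ℕ) + 1) / K) := fun K => by
    have h1 : Measurable fun u : ℝ≥0 => ⌊u * K⌋₊ :=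
      Nat.measurable_floor.comp (measurable_id.mul_const _)
    exact (measurable_from_nat (f := fun j : ℕ => g (((j : ℝ≥0) + 1) / K))).comp h1
  refine measurable_of_tendsto_metrizable hm (tendsto_pi_nhds.2 fun u => ?_)
  refine (h u).tendsto.comp (tendsto_nhdsWithin_iff.2 ⟨?_, ?_⟩)
  · have h2 : Tendsto (fun K : ℕ => u + 1 / (K : ℝ≥0)) atTop (𝓝 u) := by
      simpa using tendsto_const_nhds.add (tendsto_one_div_atTop_nhds_zero_nat (𝕜 := ℝ≥0))
    refine tendsto_of_tendsto_of_tendsto_of_le_of_le' tendsto_const_nhds h2 ?_ ?_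
    · filter_upwards [eventually_gt_atTop 0] with K hK
      have hK' : (0 : ℝ≥0) < K := by exact_mod_cast hK
      exact (le_div_iff₀ hK').2 (Nat.lt_floor_add_one _).le
    · filter_upwards [eventually_gt_atTop 0] with K hK
      have hK' : (0 : ℝ≥0) < K := by exact_mod_cast hK
      rw [add_div]
      gcongr
      exact (div_le_iff₀ hK').2 (Nat.floor_le (by positivity))
  · filter_upwards [eventually_gt_atTop 0] with K hK
    have hK' : (0 : ℝ≥0) < K := by exact_mod_cast hK
    exact (le_div_iff₀ hK').2 (Nat.lt_floor_add_one _).le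

end Paths

/-! ### Error of a single time step. -/

section StepError

variable {d : ℕ}

/-- The intensity `(λᵀ x) (n - ν)` along a path. -/
noncomputable def hazard (lam : Fin d → ℝ) (n : ℕ) (x : ℝ≥0 → Fin d → ℝ) (ν : ℝ≥0 → ℕ)
    (u : ℝ≥0) : ℝ :=
  (lam ⬝ᵥ x u) * ((n : ℝ) - ν u)

/-- The increment of the compensator over `[a, b]`. -/
noncomputable def compensator (lam : Fin d → ℝ) (n : ℕ) (x : ℝ≥0 → Fin d → ℝ) (ν : ℝ≥0 → ℕ)
    (a b : ℝ≥0) : ℝ :=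
  ∫ u in (a : ℝ)..b, hazard lam n x ν u.toNNReal

/-- The increment of `f(ν) x` over `[a, b]`, relative to the propagator `B`, after the martingale
increments of `x` (with propagator `A`) and of `ν` have been removed. -/
noncomputable def stepError (f : ℕ → ℝ) (lam : Fin d → ℝ) (n : ℕ) (A B : Matrix (Fin d) (Fin d) ℝ)
    (x : ℝ≥0 → Fin d → ℝ) (ν : ℝ≥0 → ℕ) (a b : ℝ≥0) : Fin d → ℝ :=
  f (ν b) • x b - B *ᵥ (f (ν a) • x a) - f (ν a) • (x b - A *ᵥ x a)
    - ((f (ν a + 1) - f (ν a)) * ((ν b : ℝ) - ν a - compensator lam n x ν a b)) • x a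

variable {f : ℕ → ℝ} {lam : Fin d → ℝ} {n m : ℕ} {A B : Matrix (Fin d) (Fin d) ℝ}
  {x : ℝ≥0 → Fin d → ℝ} {ν : ℝ≥0 → ℕ} {a b : ℝ≥0} {C ρ : ℝ}

theorem norm_le_one_of_mem_basis {v : Fin d → ℝ} (h : ∃ i, v = Pi.single i 1) : ‖v‖ ≤ 1 := by
  obtain ⟨i, rfl⟩ := h
  rw [pi_norm_le_iff_of_nonneg zero_le_one]
  intro j
  by_cases hj : j = i
  · subst hj; simp
  · simp [hj]

theorem diagonal_mulVec_of_mem_basis {v : Fin d → ℝ} (h : ∃ i, v = Pi.single i 1) :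
    Matrix.diagonal lam *ᵥ v = (lam ⬝ᵥ v) • v := by
  obtain ⟨i, rfl⟩ := h
  ext j
  rw [Matrix.mulVec_diagonal]
  by_cases hj : j = i
  · subst hj; simp
  · simp [hj]

theorem dotProduct_mem_Icc_of_mem_basis (hlam : ∀ i, 0 ≤ lam i) {v : Fin d → ℝ}
    (h : ∃ i, v = Pi.single i 1) : lam ⬝ᵥ v ∈ Set.Icc 0 (∑ i, lam i) := by
  obtain ⟨i, rfl⟩ := h
  simp only [dotProduct_single, mul_one]
  exact ⟨hlam i, Finset.single_le_sum (fun j _ => hlam j) (Finset.mem_univ i)⟩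

theorem abs_hazard_le (hlam : ∀ i, 0 ≤ lam i) (hx : ∀ u, ∃ i, x u = Pi.single i 1)
    (hν : ∀ u, ν u ≤ n) (u : ℝ≥0) : |hazard lam n x ν u| ≤ (∑ i, lam i) * n := by
  have h1 := dotProduct_mem_Icc_of_mem_basis hlam (hx u)
  have h2 : (ν u : ℝ) ≤ n := by exact_mod_cast hν u
  have h3 : (0 : ℝ) ≤ ν u := by positivity
  rw [hazard, abs_of_nonneg (mul_nonneg h1.1 (by linarith))]
  exact mul_le_mul h1.2 (by linarith) (by linarith) (h1.1.trans h1.2)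

theorem abs_compensator_le (hlam : ∀ i, 0 ≤ lam i) (hx : ∀ u, ∃ i, x u = Pi.single i 1)
    (hν : ∀ u, ν u ≤ n) (hab : a ≤ b) :
    |compensator lam n x ν a b| ≤ (∑ i, lam i) * n * ((b : ℝ) - a) := by
  have hab' : (a : ℝ) ≤ b := by exact_mod_cast hab
  have h := intervalIntegral.norm_integral_le_of_norm_le_const (a := (a : ℝ)) (b := b)
    (f := fun u => hazard lam n x ν u.toNNReal) (C := (∑ i, lam i) * n)
    fun u _ => abs_hazard_le hlam hx hν _
  rwa [abs_of_nonneg (sub_nonneg.2 hab'), Real.norm_eq_abs] at h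

theorem compensator_of_const (hab : a ≤ b) (h : ∀ u ∈ Set.Icc a b, x u = x a ∧ ν u = ν a) :
    compensator lam n x ν a b = ((b : ℝ) - a) * hazard lam n x ν a := by
  have hab' : (a : ℝ) ≤ b := by exact_mod_cast hab
  rw [compensator, intervalIntegral.integral_congr (g := fun _ => hazard lam n x ν a)]
  · simp
  · intro u hu
    rw [Set.uIcc_of_le hab'] at hu
    obtain ⟨h1, h2⟩ := h u.toNNReal
      ⟨Real.toNNReal_coe (r := a) ▸ Real.toNNReal_le_toNNReal hu.1,
        Real.toNNReal_le_iff_le_coe.2 hu.2⟩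
    simp only [hazard, h1, h2]

/-- The hypotheses on the function `f` and the propagators `A`, `B` over a time step `δ`. -/
structure IsStepData (f : ℕ → ℝ) (lam : Fin d → ℝ) (n m : ℕ) (C ρ δ : ℝ)
    (A B : Matrix (Fin d) (Fin d) ℝ) : Prop where
  lam_nonneg : ∀ i, 0 ≤ lam i
  bound : ∀ k, |f k| ≤ C
  diff : ∀ k ≤ n, (f (k + 1) - f k) * ((n : ℝ) - k) = -(m * f k)
  remainder : ∀ v : Fin d → ℝ,
    ‖A *ᵥ v - B *ᵥ v - δ • (((m : ℝ) • Matrix.diagonal lam) *ᵥ v)‖ ≤ ρ * ‖v‖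

/-- Splits the error into a jump part, the second-order remainder of the propagators, and a drift
part comparing the compensator with `δ m λᵀx`. -/
theorem stepError_eq (hx : ∃ i, x a = Pi.single i 1) (δ : ℝ) :
    stepError f lam n A B x ν a b =
      ((f (ν b) - f (ν a)) • x b - ((f (ν a + 1) - f (ν a)) * ((ν b : ℝ) - ν a)) • x a)
      + f (ν a) • (A *ᵥ x a - B *ᵥ x a - δ • (((m : ℝ) • Matrix.diagonal lam) *ᵥ x a))
      + (f (ν a) * (δ * m * (lam ⬝ᵥ x a))
          + (f (ν a + 1) - f (ν a)) * compensator lam n x ν a b) • x a := by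
  rw [stepError, Matrix.smul_mulVec, diagonal_mulVec_of_mem_basis hx, Matrix.mulVec_smul]
  module

theorem IsStepData.norm_stepError_le_of_const (h : IsStepData f lam n m C ρ ((b : ℝ) - a) A B)
    (hx : ∀ u, ∃ i, x u = Pi.single i 1) (hν : ∀ u, ν u ≤ n) (hρ : 0 ≤ ρ) (hab : a ≤ b)
    (hc : ∀ u ∈ Set.Icc a b, x u = x a ∧ ν u = ν a) :
    ‖stepError f lam n A B x ν a b‖ ≤ C * ρ := by
  obtain ⟨h1, h2⟩ := hc b (Set.right_mem_Icc.2 hab)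
  -- Without jumps the compensator is explicit, and the eigenfunction identity cancels the drift
  -- part exactly.
  have hz : f (ν a) * (((b : ℝ) - a) * m * (lam ⬝ᵥ x a))
      + (f (ν a + 1) - f (ν a)) * compensator lam n x ν a b = 0 := by
    rw [compensator_of_const hab hc, hazard]
    linear_combination ((b : ℝ) - a) * (lam ⬝ᵥ x a) * h.diff (ν a) (hν a)
  rw [stepError_eq (m := m) (hx a) ((b : ℝ) - a), hz, h1, h2]
  simp only [sub_self, zero_smul, mul_zero, zero_add, add_zero, norm_smul]
  have hC : 0 ≤ C := (abs_nonneg _).trans (h.bound 0)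
  refine mul_le_mul (h.bound _) ((h.remainder _).trans ?_) (norm_nonneg _) hC
  exact mul_le_of_le_one_right hρ (norm_le_one_of_mem_basis (hx a))

/-- In the constant, `m` comes from the term `δ m λᵀx`, and `2 * n` from `|f (k + 1) - f k| ≤ 2C`
times the bound on the compensator. -/
theorem IsStepData.norm_stepError_sub_le (h : IsStepData f lam n m C ρ ((b : ℝ) - a) A B)
    (hx : ∀ u, ∃ i, x u = Pi.single i 1) (hν : ∀ u, ν u ≤ n) (hρ : 0 ≤ ρ) (hab : a ≤ b) :
    ‖stepError f lam n A B x ν a b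
      - ((f (ν b) - f (ν a)) • x b - ((f (ν a + 1) - f (ν a)) * ((ν b : ℝ) - ν a)) • x a)‖
      ≤ C * ρ + C * (∑ i, lam i) * (m + 2 * n) * ((b : ℝ) - a) := by
  have hC : 0 ≤ C := (abs_nonneg _).trans (h.bound 0)
  have hab' : 0 ≤ (b : ℝ) - a := sub_nonneg.2 (by exact_mod_cast hab)
  have hx1 := norm_le_one_of_mem_basis (hx a)
  have hl := dotProduct_mem_Icc_of_mem_basis h.lam_nonneg (hx a)
  have hL : 0 ≤ ∑ i, lam i := hl.1.trans hl.2
  rw [stepError_eq (m := m) (hx a) ((b : ℝ) - a), add_assoc, add_sub_cancel_left]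
  refine (norm_add_le _ _).trans (add_le_add ?_ ?_)
  · rw [norm_smul]
    refine mul_le_mul (h.bound _) ((h.remainder _).trans ?_) (norm_nonneg _) hC
    exact mul_le_of_le_one_right hρ hx1
  · rw [norm_smul]
    refine (mul_le_of_le_one_right (norm_nonneg _) hx1).trans ?_
    have e1 : |f (ν a) * (((b : ℝ) - a) * m * (lam ⬝ᵥ x a))|
        ≤ C * (((b : ℝ) - a) * m * ∑ i, lam i) := by
      rw [abs_mul]
      refine mul_le_mul (h.bound _) ?_ (abs_nonneg _) hC
      rw [abs_of_nonneg (mul_nonneg (by positivity) hl.1)]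
      exact mul_le_mul_of_nonneg_left hl.2 (by positivity)
    have e2 : |(f (ν a + 1) - f (ν a)) * compensator lam n x ν a b|
        ≤ (C + C) * ((∑ i, lam i) * n * ((b : ℝ) - a)) := by
      rw [abs_mul]
      refine mul_le_mul ?_ (abs_compensator_le h.lam_nonneg hx hν hab) (abs_nonneg _) (by positivity)
      exact (abs_sub _ _).trans (add_le_add (h.bound _) (h.bound _))
    rw [Real.norm_eq_abs]
    refine (abs_add_le _ _).trans ((add_le_add e1 e2).trans (le_of_eq ?_))
    ring

theorem IsStepData.norm_stepError_le_of_single (h : IsStepData f lam n m C ρ ((b : ℝ) - a) A B)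
    (hx : ∀ u, ∃ i, x u = Pi.single i 1) (hν : ∀ u, ν u ≤ n) (hρ : 0 ≤ ρ) (hab : a ≤ b)
    (hmono : ν a ≤ ν b) (h1 : x b = x a ∨ ν b = ν a) (h2 : ν b ≤ ν a + 1) :
    ‖stepError f lam n A B x ν a b‖
      ≤ C * ρ + C * (∑ i, lam i) * (m + 2 * n) * ((b : ℝ) - a) := by
  -- Here the absence of common jumps and the unit jump size enter: if `ν` moves, it moves by one
  -- and `x` does not.
  have hz : (f (ν b) - f (ν a)) • x b - ((f (ν a + 1) - f (ν a)) * ((ν b : ℝ) - ν a)) • x a = 0 := by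
    rcases hmono.eq_or_lt with he | hlt
    · simp [← he]
    · have hb : ν b = ν a + 1 := by lia
      have hxx : x b = x a := h1.resolve_right (by lia)
      simp [hb, hxx]
  simpa only [hz, sub_zero] using h.norm_stepError_sub_le hx hν hρ hab

/-- A crude bound valid for any number of jumps in the step; its first term telescopes over a
partition, which provides the domination. -/
theorem IsStepData.norm_stepError_le (h : IsStepData f lam n m C ρ ((b : ℝ) - a) A B)
    (hx : ∀ u, ∃ i, x u = Pi.single i 1) (hν : ∀ u, ν u ≤ n) (hρ : 0 ≤ ρ) (hab : a ≤ b)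
    (hmono : ν a ≤ ν b) :
    ‖stepError f lam n A B x ν a b‖
      ≤ 4 * C * ((ν b : ℝ) - ν a) + (C * ρ + C * (∑ i, lam i) * (m + 2 * n) * ((b : ℝ) - a)) := by
  have hC : 0 ≤ C := (abs_nonneg _).trans (h.bound 0)
  have hmono' : 0 ≤ (ν b : ℝ) - ν a := sub_nonneg.2 (by exact_mod_cast hmono)
  have hd : ∀ i j, |f i - f j| ≤ C + C := fun i j =>
    (abs_sub _ _).trans (add_le_add (h.bound _) (h.bound _))
  have e1 : |f (ν b) - f (ν a)| ≤ (C + C) * ((ν b : ℝ) - ν a) := by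
    rcases hmono.eq_or_lt with he | hlt
    · simp [← he]
    · have : (ν a : ℝ) + 1 ≤ ν b := by exact_mod_cast hlt
      exact (hd _ _).trans (le_mul_of_one_le_right (by positivity) (by linarith))
  have e2 : |(f (ν a + 1) - f (ν a)) * ((ν b : ℝ) - ν a)| ≤ (C + C) * ((ν b : ℝ) - ν a) := by
    rw [abs_mul, abs_of_nonneg hmono']
    exact mul_le_mul_of_nonneg_right (hd _ _) hmono'
  have e3 := h.norm_stepError_sub_le hx hν hρ hab
  have e4 : ‖(f (ν b) - f (ν a)) • x b - ((f (ν a + 1) - f (ν a)) * ((ν b : ℝ) - ν a)) • x a‖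
      ≤ 4 * C * ((ν b : ℝ) - ν a) := by
    refine (norm_sub_le _ _).trans ?_
    rw [norm_smul, norm_smul]
    have f1 := mul_le_of_le_one_right (norm_nonneg (f (ν b) - f (ν a)))
      (norm_le_one_of_mem_basis (hx b))
    have f2 := mul_le_of_le_one_right (norm_nonneg ((f (ν a + 1) - f (ν a)) * ((ν b : ℝ) - ν a)))
      (norm_le_one_of_mem_basis (hx a))
    rw [← Real.norm_eq_abs] at e1 e2
    linarith
  have e5 := norm_add_le (stepError f lam n A B x ν a b
      - ((f (ν b) - f (ν a)) • x b - ((f (ν a + 1) - f (ν a)) * ((ν b : ℝ) - ν a)) • x a))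
    ((f (ν b) - f (ν a)) • x b - ((f (ν a + 1) - f (ν a)) * ((ν b : ℝ) - ν a)) • x a)
  rw [sub_add_cancel] at e5
  linarith

end StepError

/-! ### Summing the errors over equal partitions. -/

section Partition

/-- The `i`-th point of the partition of `[s, t]` into `K` intervals of equal length. -/
noncomputable def partitionPoint (s t : ℝ≥0) (K i : ℕ) : ℝ≥0 :=
  s + i * ((t - s) / K)

variable {s t : ℝ≥0} {K : ℕ}

theorem partitionPoint_zero : partitionPoint s t K 0 = s := by simp [partitionPoint]

theorem partitionPoint_last (hst : s ≤ t) (hK : 0 < K) : partitionPoint s t K K = t := by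
  have : (K : ℝ≥0) ≠ 0 := by positivity
  rw [partitionPoint, mul_div_cancel₀ _ this, add_tsub_cancel_of_le hst]

theorem partitionPoint_mono : Monotone (partitionPoint s t K) := fun i j hij => by
  unfold partitionPoint
  gcongr

theorem le_partitionPoint (i : ℕ) : s ≤ partitionPoint s t K i := le_self_add

theorem partitionPoint_le (hst : s ≤ t) {i : ℕ} (hi : i ≤ K) (hK : 0 < K) :
    partitionPoint s t K i ≤ t :=
  (partitionPoint_mono hi).trans_eq (partitionPoint_last hst hK)

theorem partitionPoint_succ_sub (hst : s ≤ t) (i : ℕ) :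
    (partitionPoint s t K (i + 1) : ℝ) - partitionPoint s t K i = ((t : ℝ) - s) / K := by
  simp only [partitionPoint, NNReal.coe_add, NNReal.coe_mul, NNReal.coe_natCast, NNReal.coe_div,
    NNReal.coe_sub hst]
  push_cast
  ring

variable {d : ℕ} {f : ℕ → ℝ} {lam : Fin d → ℝ} {n m : ℕ} {A B : ℝ → Matrix (Fin d) (Fin d) ℝ}
  {x : ℝ≥0 → Fin d → ℝ} {ν : ℝ≥0 → ℕ} {C : ℝ} {ρ : ℝ → ℝ}

theorem sum_norm_stepError_le (h : ∀ δ, IsStepData f lam n m C (ρ δ) δ (A δ) (B δ))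
    (hx : ∀ u, ∃ i, x u = Pi.single i 1) (hν : ∀ u, ν u ≤ n) (hmono : Monotone ν)
    (hρ : ∀ δ, 0 ≤ ρ δ) (hst : s ≤ t) (hK : 0 < K) :
    ∑ i ∈ Finset.range K, ‖stepError f lam n (A (((t : ℝ) - s) / K)) (B (((t : ℝ) - s) / K)) x ν
        (partitionPoint s t K i) (partitionPoint s t K (i + 1))‖
      ≤ 4 * C * n + C * (K * ρ (((t : ℝ) - s) / K))
        + C * (∑ i, lam i) * (m + 2 * n) * ((t : ℝ) - s) := by
  set δ := ((t : ℝ) - s) / K with hδ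
  have hC : 0 ≤ C := (abs_nonneg _).trans ((h 0).bound 0)
  have hK' : (K : ℝ) ≠ 0 := by positivity
  have hKδ : K * δ = (t : ℝ) - s := mul_div_cancel₀ _ hK'
  calc _ ≤ ∑ i ∈ Finset.range K, (4 * C * ((ν (partitionPoint s t K (i + 1)) : ℝ)
          - ν (partitionPoint s t K i)) + (C * ρ δ + C * (∑ i, lam i) * (m + 2 * n) * δ)) := by
        refine Finset.sum_le_sum fun i _ => ?_
        have hd : (partitionPoint s t K (i + 1) : ℝ) - partitionPoint s t K i = δ :=
          partitionPoint_succ_sub (K := K) hst i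
        have hs : IsStepData f lam n m C (ρ δ)
            ((partitionPoint s t K (i + 1) : ℝ) - partitionPoint s t K i) (A δ) (B δ) := by
          rw [hd]; exact h δ
        have hle : partitionPoint s t K i ≤ partitionPoint s t K (i + 1) :=
          partitionPoint_mono i.le_succ
        have := hs.norm_stepError_le hx hν (hρ δ) hle (hmono hle)
        rwa [hd] at this
    _ = 4 * C * ((ν t : ℝ) - ν s) + K * (C * ρ δ + C * (∑ i, lam i) * (m + 2 * n) * δ) := by
        rw [Finset.sum_add_distrib, ← Finset.mul_sum,
          Finset.sum_range_sub (fun i => (ν (partitionPoint s t K i) : ℝ)),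
          partitionPoint_last hst hK, partitionPoint_zero, Finset.sum_const, Finset.card_range,
          nsmul_eq_mul]
    _ ≤ _ := by
        have h1 : (ν t : ℝ) ≤ n := by exact_mod_cast hν t
        have h2 : (0 : ℝ) ≤ ν s := by positivity
        have h3 : 4 * C * ((ν t : ℝ) - ν s) ≤ 4 * C * n :=
          mul_le_mul_of_nonneg_left (by linarith) (by positivity)
        have h4 : K * (C * ρ δ + C * (∑ i, lam i) * (m + 2 * n) * δ)
            = C * (K * ρ δ) + C * (∑ i, lam i) * (m + 2 * n) * ((t : ℝ) - s) := by
          rw [← hKδ]; ring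
        linarith

theorem sum_norm_stepError_le_card (h : ∀ δ, IsStepData f lam n m C (ρ δ) δ (A δ) (B δ))
    (hx : ∀ u, ∃ i, x u = Pi.single i 1) (hν : ∀ u, ν u ≤ n) (hmono : Monotone ν)
    (hρ : ∀ δ, 0 ≤ ρ δ) (hst : s ≤ t) (hK : 0 < K) {J : Finset ℝ≥0} {ε : ℝ}
    (hJ : ∀ a b, s ≤ a → a ≤ b → b ≤ t → (b : ℝ) - a < ε →
      ((∃ τ ∈ J, a < τ ∧ τ ≤ b) ∨ ∀ u ∈ Set.Icc a b, x u = x a ∧ ν u = ν a) ∧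
      (x b = x a ∨ ν b = ν a) ∧ ν b ≤ ν a + 1) (hε : ((t : ℝ) - s) / K < ε) :
    ∑ i ∈ Finset.range K, ‖stepError f lam n (A (((t : ℝ) - s) / K)) (B (((t : ℝ) - s) / K)) x ν
        (partitionPoint s t K i) (partitionPoint s t K (i + 1))‖
      ≤ C * (K * ρ (((t : ℝ) - s) / K))
        + J.card * (C * (∑ i, lam i) * (m + 2 * n) * (((t : ℝ) - s) / K)) := by
  classical
  set δ := ((t : ℝ) - s) / K with hδ
  set p := partitionPoint s t K with hp
  have hC : 0 ≤ C := (abs_nonneg _).trans ((h 0).bound 0)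
  have hL : 0 ≤ ∑ i, lam i := Finset.sum_nonneg fun i _ => (h 0).lam_nonneg i
  have hδ0 : 0 ≤ δ := div_nonneg (sub_nonneg.2 (by exact_mod_cast hst)) (by positivity)
  set c := C * (∑ i, lam i) * (m + 2 * n) * δ with hc
  have hc0 : 0 ≤ c := by positivity
  let bad : ℕ → Prop := fun i => ∃ τ ∈ J, p i < τ ∧ τ ≤ p (i + 1)
  -- The half-open steps are disjoint, so choosing a point of `J` in each bad step is injective.
  have hcard : ((Finset.range K).filter bad).card ≤ J.card := by
    have hbad : ∀ i, ∃ τ, bad i → τ ∈ J ∧ p i < τ ∧ τ ≤ p (i + 1) := fun i => by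
      by_cases hi : bad i
      · obtain ⟨τ, h⟩ := hi
        exact ⟨τ, fun _ => h⟩
      · exact ⟨0, fun h => absurd h hi⟩
    choose g hg using hbad
    refine Finset.card_le_card_of_injOn g (fun i hi => (hg i (Finset.mem_filter.1 hi).2).1) ?_
    intro i hi j hj hij
    have hi' := (hg i (Finset.mem_filter.1 hi).2).2
    have hj' := (hg j (Finset.mem_filter.1 hj).2).2
    by_contra hne
    rcases lt_or_gt_of_ne hne with hlt | hlt
    · have : p (i + 1) ≤ p j := partitionPoint_mono hlt
      exact absurd (hi'.2.trans this) (not_le.2 (hij ▸ hj'.1))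
    · have : p (j + 1) ≤ p i := partitionPoint_mono hlt
      exact absurd (hj'.2.trans this) (not_le.2 (hij ▸ hi'.1))
  calc _ ≤ ∑ i ∈ Finset.range K, (C * ρ δ + if bad i then c else 0) := by
        refine Finset.sum_le_sum fun i hi => ?_
        have hd : (p (i + 1) : ℝ) - p i = δ := partitionPoint_succ_sub (K := K) hst i
        have hs : IsStepData f lam n m C (ρ δ) ((p (i + 1) : ℝ) - p i) (A δ) (B δ) := by
          rw [hd]; exact h δ
        have hle : p i ≤ p (i + 1) := partitionPoint_mono i.le_succ
        obtain ⟨h1, h2, h3⟩ := hJ (p i) (p (i + 1)) (le_partitionPoint i) hle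
          (partitionPoint_le hst (Finset.mem_range.1 hi) hK) (hd.trans_lt hε)
        split_ifs with hb
        · have := hs.norm_stepError_le_of_single hx hν (hρ δ) hle
            (hmono hle) h2 h3
          rwa [hd] at this
        · simpa using hs.norm_stepError_le_of_const hx hν (hρ δ) hle
            (h1.resolve_left hb)
    _ = C * (K * ρ δ) + ((Finset.range K).filter bad).card * c := by
        rw [Finset.sum_add_distrib, ← Finset.sum_filter]
        simp only [Finset.sum_const, Finset.card_range, nsmul_eq_mul]
        ring
    _ ≤ _ := by gcongr

theorem IsModulatedPath.tendsto_sum_norm_stepError (hp : IsModulatedPath x ν)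
    (h : ∀ δ, IsStepData f lam n m C (ρ δ) δ (A δ) (B δ))
    (hx : ∀ u, ∃ i, x u = Pi.single i 1) (hν : ∀ u, ν u ≤ n)
    (hρ : ∀ δ, 0 ≤ ρ δ) (hst : s ≤ t)
    (hρ0 : Tendsto (fun K : ℕ => (K : ℝ) * ρ (((t : ℝ) - s) / K)) atTop (𝓝 0)) :
    Tendsto (fun K : ℕ => ∑ i ∈ Finset.range K,
      ‖stepError f lam n (A (((t : ℝ) - s) / K)) (B (((t : ℝ) - s) / K)) x ν
        (partitionPoint s t K i) (partitionPoint s t K (i + 1))‖) atTop (𝓝 0) := by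
  obtain ⟨J, ε, hε, hJ⟩ := hp.exists_finset s t
  have hd : Tendsto (fun K : ℕ => ((t : ℝ) - s) / K) atTop (𝓝 0) :=
    tendsto_const_div_atTop_nhds_zero_nat _
  have hlim : Tendsto (fun K : ℕ => C * (K * ρ (((t : ℝ) - s) / K))
        + J.card * (C * (∑ i, lam i) * (m + 2 * n) * (((t : ℝ) - s) / K))) atTop (𝓝 0) := by
    have := (hρ0.const_mul C).add
      ((hd.const_mul (C * (∑ i, lam i) * (m + 2 * n))).const_mul (J.card : ℝ))
    simpa only [mul_zero, add_zero] using this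
  refine squeeze_zero' (Eventually.of_forall fun K => Finset.sum_nonneg fun _ _ => norm_nonneg _)
    ?_ hlim
  filter_upwards [eventually_gt_atTop 0, hd.eventually_lt_const hε] with K hK hKε
  exact sum_norm_stepError_le_card h hx hν hp.mono hρ hst hK hJ hKε

end Partition

/-! ### Centred variables times bounded measurable factors. -/

section PullOut

variable {Ω E : Type*} {m mΩ : MeasurableSpace Ω} {μ : Measure Ω} [IsFiniteMeasure μ]
  [NormedAddCommGroup E] [NormedSpace ℝ E] [CompleteSpace E]

theorem setIntegral_smul_eq_zero_of_condExp_eq_zero_right (hm : m ≤ mΩ) {g : Ω → ℝ} {Z : Ω → E}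
    (hg : StronglyMeasurable[m] g) {c : ℝ} (hc : ∀ ω, ‖g ω‖ ≤ c) (hZ : Integrable Z μ)
    (h0 : μ[Z | m] =ᵐ[μ] 0) {S : Set Ω} (hS : MeasurableSet[m] S) :
    ∫ ω in S, g ω • Z ω ∂μ = 0 := by
  have hi : Integrable (g • Z) μ :=
    hZ.bdd_smul c (hg.mono hm).aestronglyMeasurable (Eventually.of_forall hc)
  have h := condExp_smul_of_aestronglyMeasurable_left hg.aestronglyMeasurable hi hZ
  have h' : μ[g • Z | m] =ᵐ[μ] 0 := by
    filter_upwards [h, h0] with ω h1 h2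
    simp [h1, h2]
  have h2 := setIntegral_condExp hm hi hS
  rw [setIntegral_congr_ae (hm _ hS) (h'.mono fun ω h _ => h)] at h2
  simpa using h2.symm

theorem setIntegral_smul_eq_zero_of_condExp_eq_zero_left (hm : m ≤ mΩ) {Z : Ω → ℝ} {g : Ω → E}
    (hg : StronglyMeasurable[m] g) {c : ℝ} (hc : ∀ ω, ‖g ω‖ ≤ c) (hZ : Integrable Z μ)
    (h0 : μ[Z | m] =ᵐ[μ] 0) {S : Set Ω} (hS : MeasurableSet[m] S) :
    ∫ ω in S, Z ω • g ω ∂μ = 0 := by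
  have hi : Integrable (Z • g) μ :=
    hZ.smul_bdd c (hg.mono hm).aestronglyMeasurable (Eventually.of_forall hc)
  have h := condExp_smul_of_aestronglyMeasurable_right hZ hi hg.aestronglyMeasurable
  have h' : μ[Z • g | m] =ᵐ[μ] 0 := by
    filter_upwards [h, h0] with ω h1 h2
    simp [h1, h2]
  have h2 := setIntegral_condExp hm hi hS
  rw [setIntegral_congr_ae (hm _ hS) (h'.mono fun ω h _ => h)] at h2
  simpa using h2.symm

end PullOut

theorem integrable_mulVec {Ω : Type*} {mΩ : MeasurableSpace Ω} {μ : Measure Ω} {d : ℕ}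
    (M : Matrix (Fin d) (Fin d) ℝ) {g : Ω → Fin d → ℝ} (hg : Integrable g μ) :
    Integrable (fun ω => M *ᵥ g ω) μ :=
  (LinearMap.toContinuousLinearMap M.mulVecLin).integrable_comp hg

theorem integral_mulVec {Ω : Type*} {mΩ : MeasurableSpace Ω} {μ : Measure Ω} {d : ℕ}
    (M : Matrix (Fin d) (Fin d) ℝ) {g : Ω → Fin d → ℝ} (hg : Integrable g μ) :
    ∫ ω, M *ᵥ g ω ∂μ = M *ᵥ ∫ ω, g ω ∂μ :=
  (LinearMap.toContinuousLinearMap M.mulVecLin).integral_comp_comm hg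

/-! ### Integrability and additivity of the compensator. -/

section Compensator

variable {d n : ℕ} {lam : Fin d → ℝ} {x : ℝ≥0 → Fin d → ℝ} {ν : ℝ≥0 → ℕ}

theorem intervalIntegrable_hazard (hlam : ∀ i, 0 ≤ lam i) (hx : ∀ u, ∃ i, x u = Pi.single i 1)
    (hν : ∀ u, ν u ≤ n) (hxc : IsCadlagPath x) (hνc : IsCadlagPath ν) (a b : ℝ) :
    IntervalIntegrable (fun u => hazard lam n x ν u.toNNReal) volume a b := by
  have hxm : Measurable x := measurable_of_rightContinuous fun t => (hxc t).1
  have hνm : Measurable ν := measurable_of_rightContinuous fun t => (hνc t).1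
  have hm : Measurable (hazard lam n x ν) := by
    have h1 : Measurable fun u => lam ⬝ᵥ x u :=
      (Continuous.dotProduct continuous_const continuous_id).measurable.comp hxm
    exact h1.mul (measurable_const.sub ((measurable_from_nat (f := fun j : ℕ => (j : ℝ))).comp hνm))
  have hm' : Measurable fun u : ℝ => hazard lam n x ν u.toNNReal := hm.comp measurable_real_toNNReal
  rw [intervalIntegrable_iff]
  exact Measure.integrableOn_of_bounded (by simp [Set.uIoc]) hm'.aestronglyMeasurable
    (M := (∑ i, lam i) * n) (Eventually.of_forall fun u => abs_hazard_le hlam hx hν _)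

theorem compensator_eq_sub (hlam : ∀ i, 0 ≤ lam i) (hx : ∀ u, ∃ i, x u = Pi.single i 1)
    (hν : ∀ u, ν u ≤ n) (hxc : IsCadlagPath x) (hνc : IsCadlagPath ν) (a b : ℝ≥0) :
    compensator lam n x ν a b = (∫ u in (0 : ℝ)..b, hazard lam n x ν u.toNNReal)
      - ∫ u in (0 : ℝ)..a, hazard lam n x ν u.toNNReal :=
  (intervalIntegral.integral_interval_sub_left
    (intervalIntegrable_hazard hlam hx hν hxc hνc _ _)
    (intervalIntegrable_hazard hlam hx hν hxc hνc _ _)).symm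

end Compensator

/-! ### Removing the martingale increments. -/

namespace IsMarkovModulated

variable {Ω : Type*} {mΩ : MeasurableSpace Ω} {μ : Measure Ω} {ℱ : Filtration ℝ≥0 mΩ} {d n : ℕ}
  {Q : Matrix (Fin d) (Fin d) ℝ} {lam : Fin d → ℝ} {X : ℝ≥0 → Ω → Fin d → ℝ} {N : ℝ≥0 → Ω → ℕ}

theorem ae_isModulatedPath (h : IsMarkovModulated μ ℱ n Q lam X N) :
    ∀ᵐ ω ∂μ, IsModulatedPath (fun u => X u ω) fun u => N u ω := by
  filter_upwards [h.counting.unit_jumps, h.no_common_jumps] with ω h1 h2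
  refine ⟨h.markovChain.cadlag ω, h.counting.cadlag ω, ?_, ?_, h.counting.mono ω, h1, h2⟩
  · refine (Set.finite_range fun i : Fin d => (Pi.single i 1 : Fin d → ℝ)).subset ?_
    rintro _ ⟨u, rfl⟩
    obtain ⟨i, hi⟩ := h.markovChain.mem_basis u ω
    exact ⟨i, hi.symm⟩
  · refine (Set.finite_Iic n).subset ?_
    rintro _ ⟨u, rfl⟩
    exact h.le_n u ω

theorem stronglyMeasurable_left (h : IsMarkovModulated μ ℱ n Q lam X N) (t : ℝ≥0) :
    StronglyMeasurable[ℱ t] (X t) :=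
  (h.markovChain.adapted t).stronglyMeasurable

theorem stronglyMeasurable_comp (h : IsMarkovModulated μ ℱ n Q lam X N) (f : ℕ → ℝ) (t : ℝ≥0) :
    StronglyMeasurable[ℱ t] fun ω => f (N t ω) :=
  (measurable_from_nat.comp (h.counting.adapted t)).stronglyMeasurable

theorem norm_left_le (h : IsMarkovModulated μ ℱ n Q lam X N) (t : ℝ≥0) (ω : Ω) : ‖X t ω‖ ≤ 1 :=
  norm_le_one_of_mem_basis (h.markovChain.mem_basis t ω)

theorem stronglyMeasurable_smul (h : IsMarkovModulated μ ℱ n Q lam X N) (f : ℕ → ℝ) (t : ℝ≥0) :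
    StronglyMeasurable[ℱ t] fun ω => f (N t ω) • X t ω :=
  (h.stronglyMeasurable_comp f t).smul (h.stronglyMeasurable_left t)

/-- The compensated counting process. -/
noncomputable def compensated (lam : Fin d → ℝ) (n : ℕ) (X : ℝ≥0 → Ω → Fin d → ℝ)
    (N : ℝ≥0 → Ω → ℕ) (t : ℝ≥0) (ω : Ω) : ℝ :=
  (N t ω : ℝ) - ∫ u in (0 : ℝ)..t, hazard lam n (fun u => X u ω) (fun u => N u ω) u.toNNReal

theorem compensated_sub (h : IsMarkovModulated μ ℱ n Q lam X N) (a b : ℝ≥0) (ω : Ω) :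
    compensated lam n X N b ω - compensated lam n X N a ω =
      (N b ω : ℝ) - N a ω - compensator lam n (fun u => X u ω) (fun u => N u ω) a b := by
  rw [compensator_eq_sub h.lam_nonneg (fun u => h.markovChain.mem_basis u ω)
    (fun u => h.le_n u ω) (h.markovChain.cadlag ω) (h.counting.cadlag ω)]
  simp only [compensated]
  ring

variable [IsProbabilityMeasure μ]

theorem integrable_left (h : IsMarkovModulated μ ℱ n Q lam X N) (t : ℝ≥0) : Integrable (X t) μ :=
  Integrable.of_bound ((h.stronglyMeasurable_left t).mono (ℱ.le t)).aestronglyMeasurable 1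
    (Eventually.of_forall (h.norm_left_le t))

theorem integrable_smul (h : IsMarkovModulated μ ℱ n Q lam X N) {f : ℕ → ℝ} {C : ℝ}
    (hf : ∀ k, |f k| ≤ C) (t : ℝ≥0) : Integrable (fun ω => f (N t ω) • X t ω) μ :=
  (h.integrable_left t).bdd_smul C
    ((h.stronglyMeasurable_comp f t).mono (ℱ.le t)).aestronglyMeasurable
    (Eventually.of_forall fun _ => hf _)

variable {f : ℕ → ℝ} {C : ℝ}

/-- The subtracted terms are increments with zero conditional expectation given `ℱ a` (by the Markov
property of `X` and the intensity of `N`), multiplied by bounded `ℱ a`-measurable factors; they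
integrate to zero over `S`. -/
theorem integrable_stepError_and_setIntegral (h : IsMarkovModulated μ ℱ n Q lam X N)
    (hf : ∀ k, |f k| ≤ C) (B : Matrix (Fin d) (Fin d) ℝ) {a b : ℝ≥0} (hab : a ≤ b) {S : Set Ω}
    (hS : MeasurableSet[ℱ a] S) :
    Integrable (fun ω => stepError f lam n (NormedSpace.exp (((b : ℝ) - a) • Q)) B
        (fun u => X u ω) (fun u => N u ω) a b) μ ∧
      ∫ ω in S, stepError f lam n (NormedSpace.exp (((b : ℝ) - a) • Q)) B
        (fun u => X u ω) (fun u => N u ω) a b ∂μ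
      = (∫ ω in S, f (N b ω) • X b ω ∂μ) - B *ᵥ ∫ ω in S, f (N a ω) • X a ω ∂μ := by
  set E := NormedSpace.exp (((b : ℝ) - a) • Q)
  have hmart : Martingale (compensated lam n X N) ℱ μ := h.intensity
  have hXa := h.integrable_left a
  have hZ1 : Integrable (X b - fun ω => E *ᵥ X a ω) μ :=
    (h.integrable_left b).sub (integrable_mulVec E hXa)
  have hZ2 : Integrable (compensated lam n X N b - compensated lam n X N a) μ :=
    (hmart.integrable b).sub (hmart.integrable a)
  have hE : StronglyMeasurable[ℱ a] fun ω => E *ᵥ X a ω :=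
    (LinearMap.toContinuousLinearMap E.mulVecLin).continuous.comp_stronglyMeasurable
      (h.stronglyMeasurable_left a)
  have h01 : μ[X b - fun ω => E *ᵥ X a ω | ℱ a] =ᵐ[μ] 0 := by
    have h1 := condExp_sub (h.integrable_left b) (integrable_mulVec E hXa) (ℱ a)
    rw [condExp_of_stronglyMeasurable (ℱ.le a) hE (integrable_mulVec E hXa)] at h1
    filter_upwards [h1, h.markovChain.markov a b hab] with ω h1 h2
    rw [h1, Pi.sub_apply, h2, Pi.zero_apply, sub_self]
  have h02 : μ[compensated lam n X N b - compensated lam n X N a | ℱ a] =ᵐ[μ] 0 := by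
    have h1 := condExp_sub (hmart.integrable b) (hmart.integrable a) (ℱ a)
    rw [condExp_of_stronglyMeasurable (ℱ.le a) (hmart.1 a) (hmart.integrable a)] at h1
    filter_upwards [h1, hmart.2 a b hab] with ω h1 h2
    rw [h1, Pi.sub_apply, h2, Pi.zero_apply, sub_self]
  have hbd : ∀ k, |f (k + 1) - f k| ≤ C + C := fun k =>
    (abs_sub _ _).trans (add_le_add (hf _) (hf _))
  have hg1 := h.stronglyMeasurable_comp f a
  have hg2 := h.stronglyMeasurable_smul (fun k => f (k + 1) - f k) a
  have hg2' : ∀ ω, ‖(f (N a ω + 1) - f (N a ω)) • X a ω‖ ≤ C + C := fun ω => by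
    rw [norm_smul]
    exact (mul_le_of_le_one_right (norm_nonneg _) (h.norm_left_le a ω)).trans (hbd _)
  have hi1 : Integrable (fun ω => f (N a ω) • (X b - fun ω => E *ᵥ X a ω) ω) μ :=
    hZ1.bdd_smul C (hg1.mono (ℱ.le a)).aestronglyMeasurable
    (Eventually.of_forall fun ω => hf _)
  have hi2 : Integrable (fun ω => (compensated lam n X N b - compensated lam n X N a) ω
      • ((f (N a ω + 1) - f (N a ω)) • X a ω)) μ :=
    hZ2.smul_bdd (C + C) (hg2.mono (ℱ.le a)).aestronglyMeasurable
    (Eventually.of_forall hg2')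
  have hz1 := setIntegral_smul_eq_zero_of_condExp_eq_zero_right (ℱ.le a) hg1 (fun ω => hf _)
    hZ1 h01 hS
  have hz2 := setIntegral_smul_eq_zero_of_condExp_eq_zero_left (ℱ.le a) hg2 hg2' hZ2 h02 hS
  have ha := h.integrable_smul hf a
  have hb := h.integrable_smul hf b
  have hBa := integrable_mulVec B ha
  have heq : (fun ω => stepError f lam n E B (fun u => X u ω) (fun u => N u ω) a b) =
      fun ω => f (N b ω) • X b ω - B *ᵥ (f (N a ω) • X a ω)
        - f (N a ω) • (X b - fun ω => E *ᵥ X a ω) ω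
        - (compensated lam n X N b - compensated lam n X N a) ω
            • ((f (N a ω + 1) - f (N a ω)) • X a ω) := by
    funext ω
    rw [Pi.sub_apply (compensated lam n X N b), h.compensated_sub, smul_smul, mul_comm]
    rfl
  rw [heq]
  have hj : Integrable (fun ω => f (N b ω) • X b ω - B *ᵥ (f (N a ω) • X a ω)) μ := hb.sub hBa
  have hj' : Integrable (fun ω => f (N b ω) • X b ω - B *ᵥ (f (N a ω) • X a ω)
      - f (N a ω) • (X b - fun ω => E *ᵥ X a ω) ω) μ := hj.sub hi1
  refine ⟨hj'.sub hi2, ?_⟩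
  rw [integral_sub hj'.integrableOn hi2.integrableOn, hz2, sub_zero,
    integral_sub hj.integrableOn hi1.integrableOn, hz1, sub_zero,
    integral_sub hb.integrableOn hBa.integrableOn, integral_mulVec B ha.integrableOn]

end IsMarkovModulated

/-! ### Binomial identities. -/

section Combinatorics

/-- With `j = n - k` this is Pascal's rule and absorption: `j (C(j, m) - C(j-1, m)) = j C(j-1, m-1)
= m C(j, m)`. At `k = n` the subtraction truncates, but then both sides are zero. -/
theorem choose_sub_diff (n m k : ℕ) (hk : k ≤ n) :
    (((n - (k + 1)).choose m : ℝ) - (n - k).choose m) * ((n : ℝ) - k)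
      = -(m * (n - k).choose m) := by
  obtain ⟨j, rfl⟩ := Nat.exists_eq_add_of_le hk
  rw [show k + j - (k + 1) = j - 1 by lia, show k + j - k = j by lia]
  push_cast
  rcases j with _ | j
  · rcases m with _ | m <;> simp
  · rcases m with _ | m
    · simp
    · have h1 : ((j : ℝ) + 1) * j.choose m = (j + 1).choose (m + 1) * (m + 1) := by
        exact_mod_cast Nat.add_one_mul_choose_eq j m
      have h2 : ((j + 1).choose (m + 1) : ℝ) = j.choose m + j.choose (m + 1) := by
        exact_mod_cast Nat.choose_succ_succ j m
      simp only [Nat.add_sub_cancel]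
      push_cast
      linear_combination -h1 - ((j : ℝ) + 1) * h2

/-- Trinomial revision followed by symmetry. For `i < j` both sides vanish. -/
theorem choose_mul_choose_of_le {n k i j : ℕ} (hk : k ≤ n) (hi : i ≤ k) (hj : j ≤ k) :
    (n - i).choose (n - k) * (n - j).choose (n - i)
      = (n - j).choose (k - j) * (k - j).choose (k - i) := by
  rw [mul_comm, Nat.choose_mul (by lia), show n - j - (n - k) = k - j by lia,
    show n - i - (n - k) = k - i by lia]
  congr 1
  rw [← Nat.choose_symm (by lia)]
  congr 1
  lia

theorem choose_sub_eq_zero {n k i j : ℕ} (hi : i ≤ k) (hj : k < j) (hjn : j ≤ n) :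
    (n - j).choose (n - i) = 0 :=
  Nat.choose_eq_zero_of_lt (by lia)

/-- After reflecting `i ↦ k - i` and dropping zero terms, this is the expansion of `(1 - 1)^(k -
j)`. -/
theorem sum_neg_one_pow_mul_choose {k j : ℕ} (hj : j ≤ k) :
    ∑ i ∈ Finset.range (k + 1), (-1 : ℝ) ^ (k - i) * ((k - j).choose (k - i) : ℝ)
      = if j = k then 1 else 0 := by
  rw [← Finset.sum_range_reflect]
  have h : ∀ l ∈ Finset.range (k + 1), k - (k + 1 - 1 - l) = l := fun l hl => by
    have := Finset.mem_range.1 hl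
    lia
  rw [Finset.sum_congr rfl fun l hl => by rw [h l hl],
    ← Finset.sum_subset (Finset.range_mono (show k - j + 1 ≤ k + 1 by lia))]
  · have := congrArg (Int.cast (R := ℝ)) (Int.alternating_sum_range_choose (n := k - j))
    push_cast at this
    rw [this]
    exact if_congr (by lia) rfl rfl
  · intro l _ hl
    rw [Nat.choose_eq_zero_of_lt (by simpa using hl)]
    simp

/-- Binomial inversion, the source of the alternating sum in the formula: the indicator of `{k}`
becomes a combination of the eigenfunctions. For `j > k` every term vanishes. -/
theorem sum_neg_one_pow_mul_choose_mul_choose {n k j : ℕ} (hk : k ≤ n) (hj : j ≤ n) :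
    ∑ i ∈ Finset.range (k + 1),
      (-1 : ℝ) ^ (k - i) * ((n - i).choose (n - k) : ℝ) * ((n - j).choose (n - i) : ℝ)
      = if j = k then 1 else 0 := by
  rcases le_or_gt j k with hjk | hjk
  · have h : ∀ i ∈ Finset.range (k + 1),
        (-1 : ℝ) ^ (k - i) * ((n - i).choose (n - k) : ℝ) * ((n - j).choose (n - i) : ℝ)
          = (n - j).choose (k - j) * ((-1 : ℝ) ^ (k - i) * ((k - j).choose (k - i) : ℝ)) := by
      intro i hi
      have : ((n - i).choose (n - k) : ℝ) * (n - j).choose (n - i)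
          = (n - j).choose (k - j) * (k - j).choose (k - i) := by
        exact_mod_cast choose_mul_choose_of_le hk (Finset.mem_range_succ_iff.1 hi) hjk
      linear_combination (-1 : ℝ) ^ (k - i) * this
    rw [Finset.sum_congr rfl h, ← Finset.mul_sum, sum_neg_one_pow_mul_choose hjk]
    split_ifs with hjk'
    · simp [hjk']
    · simp
  · rw [if_neg (by lia)]
    refine Finset.sum_eq_zero fun i hi => ?_
    rw [choose_sub_eq_zero (Finset.mem_range_succ_iff.1 hi) hjk hj]
    simp

variable {d n k ν : ℕ}

/-- Only `j = ν` survives on the left; trinomial revision then matches the coefficients that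
inversion produces. -/
theorem sum_choose_smul_mulVec (hk : k ≤ n) (hν : ν ≤ n) (E : ℕ → Matrix (Fin d) (Fin d) ℝ)
    (v : Fin d → ℝ) :
    ∑ j ∈ Finset.range (k + 1), ((n - j).choose (k - j) : ℝ) •
        ∑ i ∈ Finset.range (k + 1), ((-1 : ℝ) ^ (k - i) * ((k - j).choose (k - i) : ℝ)) •
          (E i *ᵥ (if ν = j then v else 0))
      = ∑ i ∈ Finset.range (k + 1), ((-1 : ℝ) ^ (k - i) * ((n - i).choose (n - k) : ℝ)) •
          (E i *ᵥ (((n - ν).choose (n - i) : ℝ) • v)) := by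
  rcases le_or_gt ν k with hνk | hνk
  · rw [Finset.sum_eq_single_of_mem ν (Finset.mem_range_succ_iff.2 hνk), Finset.smul_sum]
    · refine Finset.sum_congr rfl fun i hi => ?_
      have : ((n - i).choose (n - k) : ℝ) * (n - ν).choose (n - i)
          = (n - ν).choose (k - ν) * (k - ν).choose (k - i) := by
        exact_mod_cast choose_mul_choose_of_le hk (Finset.mem_range_succ_iff.1 hi) hνk
      rw [if_pos rfl, Matrix.mulVec_smul, smul_smul, smul_smul]
      congr 1
      linear_combination -(-1 : ℝ) ^ (k - i) * this
    · intro j _ hj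
      simp [hj.symm]
  · rw [Finset.sum_eq_zero, Finset.sum_eq_zero]
    · intro i hi
      rw [choose_sub_eq_zero (Finset.mem_range_succ_iff.1 hi) hνk hν]
      simp
    · intro j hj
      have : ν ≠ j := by have := Finset.mem_range.1 hj; lia
      simp [this]

/-- Again only `j = ν` matters. The ranges of `i` agree because `C(k - ν, k - i) = 0` for `i < ν`,
and both sides vanish when `ν > k`. -/
theorem sum_choose_mul_sum_mulVec (hk : k ≤ n) (hν : ν ≤ n) (E : ℕ → Matrix (Fin d) (Fin d) ℝ)
    (v : Fin d → ℝ) :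
    ∑ j ∈ Finset.range (n + 1), ((n - j).choose (n - k) : ℝ) *
        ∑ i ∈ Finset.Icc j k, (-1 : ℝ) ^ (k - i) * ((k - j).choose (k - i) : ℝ) *
          (∑ a, (E i *ᵥ v) a) * (if ν = j then 1 else 0)
      = ∑ a, (∑ j ∈ Finset.range (k + 1), ((n - j).choose (k - j) : ℝ) •
        ∑ i ∈ Finset.range (k + 1), ((-1 : ℝ) ^ (k - i) * ((k - j).choose (k - i) : ℝ)) •
          (E i *ᵥ (if ν = j then v else 0))) a := by
  rw [Finset.sum_eq_single_of_mem ν (Finset.mem_range_succ_iff.2 hν)]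
  · rcases le_or_gt ν k with hνk | hνk
    · rw [Finset.sum_eq_single_of_mem ν (Finset.mem_range_succ_iff.2 hνk)]
      · simp only [if_true, mul_one, Pi.smul_apply, Finset.sum_apply, smul_eq_mul]
        rw [← Finset.mul_sum, Finset.sum_comm]
        congr 1
        · rw [← Nat.choose_symm (by lia)]
          congr 2
          lia
        · simp only [← Finset.mul_sum]
          refine Finset.sum_subset (fun i hi => ?_) fun i hi hi' => ?_
          · exact Finset.mem_range_succ_iff.2 (Finset.mem_Icc.1 hi).2
          · rw [Nat.choose_eq_zero_of_lt]
            · simp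
            · have h1 := Finset.mem_range_succ_iff.1 hi
              have h2 : ¬ (ν ≤ i ∧ i ≤ k) := fun h => hi' (Finset.mem_Icc.2 h)
              lia
      · intro j _ hj
        simp [hj.symm]
    · rw [Finset.Icc_eq_empty (by lia), Finset.sum_empty, mul_zero,
        Finset.sum_eq_zero (M := Fin d → ℝ)]
      · simp
      · intro j hj
        have : ν ≠ j := by have := Finset.mem_range.1 hj; lia
        simp [this]
  · intro j _ hj
    simp [hj.symm]

end Combinatorics

/-! ### Conditional expectations: eigenfunctions, then indicators. -/

namespace IsMarkovModulated

variable {Ω : Type*} {mΩ : MeasurableSpace Ω} {μ : Measure Ω} {ℱ : Filtration ℝ≥0 mΩ} {d n : ℕ}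
  {Q : Matrix (Fin d) (Fin d) ℝ} {lam : Fin d → ℝ} {X : ℝ≥0 → Ω → Fin d → ℝ} {N : ℝ≥0 → Ω → ℕ}
  [IsProbabilityMeasure μ] {f : ℕ → ℝ} {C : ℝ} {m : ℕ}

theorem setIntegral_smul_eq (h : IsMarkovModulated μ ℱ n Q lam X N) (hf : ∀ k, |f k| ≤ C)
    (hdiff : ∀ k ≤ n, (f (k + 1) - f k) * ((n : ℝ) - k) = -(m * f k)) {s t : ℝ≥0} (hst : s ≤ t)
    {S : Set Ω} (hS : MeasurableSet[ℱ s] S) :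
    ∫ ω in S, f (N t ω) • X t ω ∂μ
      = NormedSpace.exp (((t : ℝ) - s) • Qlam Q lam m) *ᵥ ∫ ω in S, f (N s ω) • X s ω ∂μ := by
  set T : ℝ := (t : ℝ) - s with hT
  obtain ⟨ρ, hρ, hρ0, hrem⟩ := exists_exp_sub_exp_remainder Q (Qlam Q lam m) T
  obtain ⟨D, hD0, hD⟩ := exists_norm_exp_smul_mulVec_le (Qlam Q lam m) T
  have hQ : Q - Qlam Q lam m = (m : ℝ) • Matrix.diagonal lam := by simp [Qlam]
  rw [hQ] at hrem
  have hstep : ∀ δ, IsStepData f lam n m C (ρ δ) δ (NormedSpace.exp (δ • Q))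
      (NormedSpace.exp (δ • Qlam Q lam m)) := fun δ => ⟨h.lam_nonneg, hf, hdiff, hrem δ⟩
  have hx : ∀ ω u, ∃ i, X u ω = Pi.single i 1 := fun ω u => h.markovChain.mem_basis u ω
  have hν : ∀ ω u, N u ω ≤ n := fun ω u => h.le_n u ω
  let p : ℕ → ℕ → ℝ≥0 := partitionPoint s t
  -- Carries the error made on step `i` from the end of that step to time `t`, so that the
  -- expectations telescope.
  let M : ℕ → ℕ → Matrix (Fin d) (Fin d) ℝ := fun K i =>
    NormedSpace.exp (((t : ℝ) - p K (i + 1)) • Qlam Q lam m)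
  let r : ℕ → ℕ → Ω → Fin d → ℝ := fun K i ω =>
    stepError f lam n (NormedSpace.exp ((T / K) • Q)) (NormedSpace.exp ((T / K) • Qlam Q lam m))
      (fun u => X u ω) (fun u => N u ω) (p K i) (p K (i + 1))
  let I : ℝ≥0 → Fin d → ℝ := fun a => ∫ ω in S, f (N a ω) • X a ω ∂μ
  have hr : ∀ K i, Integrable (r K i) μ ∧ ∫ ω in S, r K i ω ∂μ
      = I (p K (i + 1)) - NormedSpace.exp ((T / K) • Qlam Q lam m) *ᵥ I (p K i) := fun K i => by
    have := h.integrable_stepError_and_setIntegral hf (NormedSpace.exp ((T / K) • Qlam Q lam m))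
      (partitionPoint_mono (s := s) (t := t) (K := K) i.le_succ)
      (ℱ.mono (le_partitionPoint i) S hS)
    rwa [Nat.succ_eq_add_one, partitionPoint_succ_sub hst] at this
  have hMr : ∀ K, 0 < K → ∀ ω, ‖∑ i ∈ Finset.range K, M K i *ᵥ r K i ω‖
      ≤ D * ∑ i ∈ Finset.range K, ‖r K i ω‖ := fun K hK ω => by
    rw [Finset.mul_sum]
    refine norm_sum_le_of_le _ fun i hi => hD _ ⟨?_, ?_⟩ _
    · have : p K (i + 1) ≤ t := partitionPoint_le hst (Finset.mem_range.1 hi) hK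
      exact sub_nonneg.2 (by exact_mod_cast this)
    · have : s ≤ p K (i + 1) := le_partitionPoint _
      exact sub_le_sub_left (by exact_mod_cast this) _
  have hint : ∀ K, 0 < K → ∫ ω in S, ∑ i ∈ Finset.range K, M K i *ᵥ r K i ω ∂μ
      = I t - NormedSpace.exp (T • Qlam Q lam m) *ᵥ I s := fun K hK => by
    let G : ℕ → Fin d → ℝ := fun i =>
      NormedSpace.exp (((t : ℝ) - p K i) • Qlam Q lam m) *ᵥ I (p K i)
    have hG : ∀ i, ∫ ω in S, M K i *ᵥ r K i ω ∂μ = G (i + 1) - G i := fun i => by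
      have hd : (p K (i + 1) : ℝ) - p K i = T / K := partitionPoint_succ_sub hst i
      rw [integral_mulVec _ (hr K i).1.integrableOn, (hr K i).2, Matrix.mulVec_sub,
        ← exp_add_smul_mulVec, ← hd, sub_add_sub_cancel]
    rw [integral_finsetSum _ fun i _ => (integrable_mulVec _ (hr K i).1).integrableOn,
      Finset.sum_congr rfl fun i _ => hG i, Finset.sum_range_sub]
    simp only [G, p, partitionPoint_zero, partitionPoint_last hst hK, sub_self, zero_smul,
      NormedSpace.exp_zero, Matrix.one_mulVec, hT]
  -- A convergent sequence is bounded: `b` makes the dominating constant independent of `K`.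
  obtain ⟨b, hb⟩ := hρ0.bddAbove_range
  have hC : 0 ≤ C := (abs_nonneg _).trans (hf 0)
  -- The shift to `K + 1` avoids the degenerate partition with no steps.
  have hlim : Tendsto (fun K : ℕ => ∫ ω in S, ∑ i ∈ Finset.range (K + 1),
      M (K + 1) i *ᵥ r (K + 1) i ω ∂μ) atTop (𝓝 (∫ ω in S, (0 : Fin d → ℝ) ∂μ)) := by
    refine tendsto_integral_of_dominated_convergence
      (fun _ => D * (4 * C * n + C * b + C * (∑ i, lam i) * (m + 2 * n) * T)) (fun K => ?_)
      (integrable_const _) (fun K => Eventually.of_forall fun ω => ?_) (ae_restrict_of_ae ?_)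
    · exact (integrable_finsetSum _ fun i _ =>
        (integrable_mulVec _ (hr (K + 1) i).1).integrableOn).aestronglyMeasurable
    · refine (hMr _ K.succ_pos ω).trans (mul_le_mul_of_nonneg_left ?_ hD0)
      refine (sum_norm_stepError_le hstep (hx ω) (hν ω) (h.counting.mono ω) hρ hst
        K.succ_pos).trans ?_
      gcongr
      exact hb ⟨K + 1, rfl⟩
    · filter_upwards [h.ae_isModulatedPath] with ω hω
      have h1 := (hω.tendsto_sum_norm_stepError hstep (hx ω) (hν ω) hρ hst hρ0).const_mul D
      rw [mul_zero] at h1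
      exact squeeze_zero_norm (fun K => hMr _ K.succ_pos ω) ((tendsto_add_atTop_iff_nat 1).2 h1)
  simp only [hint _ (Nat.succ_pos _), integral_zero] at hlim
  exact sub_eq_zero.1 (tendsto_nhds_unique tendsto_const_nhds hlim)

theorem condExp_smul_eq (h : IsMarkovModulated μ ℱ n Q lam X N) (hf : ∀ k, |f k| ≤ C)
    (hdiff : ∀ k ≤ n, (f (k + 1) - f k) * ((n : ℝ) - k) = -(m * f k)) {s t : ℝ≥0} (hst : s ≤ t) :
    μ[fun ω => f (N t ω) • X t ω | ℱ s] =ᵐ[μ]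
      fun ω => NormedSpace.exp (((t : ℝ) - s) • Qlam Q lam m) *ᵥ (f (N s ω) • X s ω) := by
  have hi := integrable_mulVec (NormedSpace.exp (((t : ℝ) - s) • Qlam Q lam m))
    (h.integrable_smul hf s)
  refine (ae_eq_condExp_of_forall_setIntegral_eq (ℱ.le s) (h.integrable_smul hf t)
    (fun S _ _ => hi.integrableOn) (fun S hS _ => ?_) ?_).symm
  · rw [h.setIntegral_smul_eq hf hdiff hst hS,
      integral_mulVec _ (h.integrable_smul hf s).integrableOn]
  · exact ((LinearMap.toContinuousLinearMap (Matrix.mulVecLin _)).continuous.comp_stronglyMeasurable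
      (h.stronglyMeasurable_smul f s)).aestronglyMeasurable

theorem abs_choose_le (n m k : ℕ) : |((n - k).choose m : ℝ)| ≤ 2 ^ n := by
  rw [Nat.abs_cast]
  exact_mod_cast (Nat.choose_le_two_pow _ _).trans (Nat.pow_le_pow_right two_pos (Nat.sub_le n k))

theorem condExp_zeta (h : IsMarkovModulated μ ℱ n Q lam X N) {s t : ℝ≥0} (hst : s ≤ t) {k : ℕ}
    (hk : k ≤ n) :
    μ[zeta X N k t | ℱ s] =ᵐ[μ] fun ω =>
      ∑ j ∈ Finset.range (k + 1), ((n - j).choose (k - j) : ℝ) •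
        ∑ i ∈ Finset.range (k + 1), ((-1 : ℝ) ^ (k - i) * ((k - j).choose (k - i) : ℝ)) •
          (NormedSpace.exp (((t : ℝ) - s) • Qlam Q lam (n - i)) *ᵥ zeta X N j s ω) := by
  -- Inversion applied at `N t ω`: each summand is an eigenfunction with `m = n - i`, for which the
  -- conditional expectation is known.
  have hz : zeta X N k t = ∑ i ∈ Finset.range (k + 1),
      ((-1 : ℝ) ^ (k - i) * ((n - i).choose (n - k) : ℝ)) •
        fun ω => ((n - N t ω).choose (n - i) : ℝ) • X t ω := by
    funext ω
    simp only [Finset.sum_apply, Pi.smul_apply, smul_smul]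
    rw [← Finset.sum_smul, sum_neg_one_pow_mul_choose_mul_choose hk (h.le_n t ω), zeta]
    simp
  have hint : ∀ i, Integrable (fun ω => ((n - N t ω).choose (n - i) : ℝ) • X t ω) μ := fun i =>
    h.integrable_smul (f := fun j => ((n - j).choose (n - i) : ℝ)) (abs_choose_le n (n - i)) t
  have h1 := condExp_finsetSum (μ := μ) (s := Finset.range (k + 1))
    (fun i _ => (hint i).smul ((-1 : ℝ) ^ (k - i) * ((n - i).choose (n - k) : ℝ))) (ℱ s)
  have h2 : ∀ᵐ ω ∂μ, ∀ i, μ[((-1 : ℝ) ^ (k - i) * ((n - i).choose (n - k) : ℝ)) •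
      fun ω => ((n - N t ω).choose (n - i) : ℝ) • X t ω | ℱ s] ω
      = ((-1 : ℝ) ^ (k - i) * ((n - i).choose (n - k) : ℝ)) •
        (NormedSpace.exp (((t : ℝ) - s) • Qlam Q lam (n - i)) *ᵥ
          (((n - N s ω).choose (n - i) : ℝ) • X s ω)) := by
    refine ae_all_iff.2 fun i => ?_
    filter_upwards [condExp_smul ((-1 : ℝ) ^ (k - i) * ((n - i).choose (n - k) : ℝ))
      (fun ω => ((n - N t ω).choose (n - i) : ℝ) • X t ω) (ℱ s),
      h.condExp_smul_eq (f := fun j => ((n - j).choose (n - i) : ℝ)) (abs_choose_le n (n - i))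
        (choose_sub_diff n (n - i)) hst] with ω e1 e2
    rw [e1, Pi.smul_apply, e2]
  rw [hz]
  filter_upwards [h1, h2] with ω e1 e2
  rw [e1, Finset.sum_apply, Finset.sum_congr rfl fun i _ => e2 i]
  exact (sum_choose_smul_mulVec hk (h.le_n s ω)
    (fun i => NormedSpace.exp (((t : ℝ) - s) • Qlam Q lam (n - i))) (X s ω)).symm

/-- The coordinates of a basis vector sum to one, and conditional expectation commutes with the
continuous linear map summing coordinates. -/
theorem condExp_indicator (h : IsMarkovModulated μ ℱ n Q lam X N) (s t : ℝ≥0) (k : ℕ) :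
    μ⟦N t ⁻¹' {k} | ℱ s⟧ =ᵐ[μ] fun ω => ∑ a, (μ[zeta X N k t | ℱ s]) ω a := by
  have hz : zeta X N k t = fun ω => (if N t ω = k then (1 : ℝ) else 0) • X t ω := by
    funext ω
    simp [zeta]
  have hi : Integrable (zeta X N k t) μ := by
    rw [hz]
    refine h.integrable_smul (f := fun j => if j = k then (1 : ℝ) else 0) (C := 1) (fun j => ?_) t
    split_ifs <;> simp
  let sumCLM : (Fin d → ℝ) →L[ℝ] ℝ := ∑ a, ContinuousLinearMap.proj a
  have hsum : ∀ v, sumCLM v = ∑ a, v a := fun v => by simp [sumCLM]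
  have he : (N t ⁻¹' {k}).indicator (fun _ => (1 : ℝ)) = sumCLM ∘ zeta X N k t := by
    funext ω
    obtain ⟨i, hi⟩ := h.markovChain.mem_basis t ω
    by_cases hN : N t ω = k <;> simp [hsum, zeta, hN, hi]
  rw [he]
  filter_upwards [sumCLM.comp_condExp_comm (m := ℱ s) hi] with ω hω
  rw [← hω, Function.comp_apply, hsum]

end IsMarkovModulated

theorem mainTheorem4 {Ω : Type*} {mΩ : MeasurableSpace Ω} (μ : Measure Ω) [IsProbabilityMeasure μ]
    (ℱ : Filtration ℝ≥0 mΩ) {d : ℕ} (n : ℕ) (Q : Matrix (Fin d) (Fin d) ℝ) (lam : Fin d → ℝ)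
    (X : ℝ≥0 → Ω → Fin d → ℝ) (N : ℝ≥0 → Ω → ℕ)
    (hmodel : IsMarkovModulated μ ℱ n Q lam X N)
    (s t : ℝ≥0) (hst : s ≤ t) (k : ℕ) (hk : k ≤ n) :
    -- the conditional probability vector `ζ^k_{t|s}`
    (μ[zeta X N k t | ℱ s] =ᵐ[μ] fun ω =>
      ∑ j ∈ Finset.range (k + 1), ((n - j).choose (k - j) : ℝ) •
        ∑ i ∈ Finset.range (k + 1), ((-1 : ℝ) ^ (k - i) * ((k - j).choose (k - i) : ℝ)) •
          (NormedSpace.exp (((t : ℝ) - s) • Qlam Q lam (n - i)) *ᵥ zeta X N j s ω)) ∧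
    -- `P(N_t = k | ℱ_s)` is the sum of its coordinates
    (μ⟦N t ⁻¹' {k} | ℱ s⟧ =ᵐ[μ] fun ω => ∑ a, (μ[zeta X N k t | ℱ s]) ω a) ∧
    -- explicit form of `P(N_t = k | ℱ_s)`
    (μ⟦N t ⁻¹' {k} | ℱ s⟧ =ᵐ[μ] fun ω =>
      ∑ j ∈ Finset.range (n + 1), ((n - j).choose (n - k) : ℝ) *
        ∑ i ∈ Finset.Icc j k, (-1 : ℝ) ^ (k - i) * ((k - j).choose (k - i) : ℝ) *
          (∑ a, (NormedSpace.exp (((t : ℝ) - s) • Qlam Q lam (n - i)) *ᵥ X s ω) a) *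
          (if N s ω = j then 1 else 0)) := by
  have h1 := hmodel.condExp_zeta hst hk
  have h2 := hmodel.condExp_indicator s t k
  refine ⟨h1, h2, ?_⟩
  filter_upwards [h1, h2] with ω e1 e2
  rw [e2, e1]
  exact (sum_choose_mul_sum_mulVec hk (hmodel.le_n s ω)
    (fun i => NormedSpace.exp (((t : ℝ) - s) • Qlam Q lam (n - i))) (X s ω)).symm
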